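/- Let $S$ be a finite set and let $\mu:S\times S\to\mathbb{R}_+$ be a directed distance on $S$, i.e. a nonnegative function with $\mu(s,s)=0$ for all $s\in S$ (neither symmetry nor the triangle inequality is assumed). A network $(G,S,c)$ consists of a finite directed graph $G=(V,E)$ (loops and parallel edges allowed) with $S\subseteq V$ and a capacity $c:E\to\mathbb{Z}_{\ge 0}$. The elements of $S$ are called terminals, the other nodes inner nodes. The network is inner Eulerian if at every inner node the total capacity of the leaving edges equals that of the entering edges. An $S$-path is a directed path joining two distinct terminals; a multiflow is a set $\mathcal{P}$ of $S$-paths with a function $\lambda:\mathcal{P}\to\mathbb{R}_+$ such that $\sum\{\lambda(P): P\in\mathcal{P},\ e\in P\}\le c(e)$ for every $e\in E$; its value is $\sum_{P\in\mathcal{P}}\lambda(P)\,\mu(s_P,t_P)$, where $s_P$ and $t_P$ are the first and the last node of $P$. Let $\mathrm{MFP}^*(\mu;G,S,c)$ be the maximum value of a multiflow. Write points of $\mathbb{R}^{S}\times\mathbb{R}^{S}$ as $p=(p^c,p^r)$, with the componentwise order, and put $$D_\infty(p,q)=\max\Big\{\max_{s\in S}\big(q^c(s)-p^c(s)\big)_+,\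 \max_{s\in S}\big(p^r(s)-q^r(s)\big)_+\Big\},$$ $$P_\mu=\{p : p^c(s)+p^r(t)\ge\mu(s,t)\ \text{for all } s,t\in S\},$$ where $a_+=\max\{a,0\}$ and maxima over the empty set are $0$. For $R\subseteq P_\mu$ let $R^+$ be the set of nonnegative points of $R$ and, for $s\in S$, let $R_s=\{p\in R : p^c(s)+p^r(s)=0\}$. Let $T_\mu$ (the directed tight span) be the set of minimal elements of $P_\mu^+$, and $Q_\mu$ the set of minimal elements of $P_\mu$. A set $R\subseteq Q_\mu$ is a section if the projection $R\to Q_\mu/\mathbb{R}(\mathbf{1},-\mathbf{1})$ is bijective. It is balanced if there are no two points $p, q\in R$ such that $p^c(s)<q^c(s)$ for all $s\in S$, or $p^r(s)<q^r(s)$ for all $s\in S$. For $R\subseteq P_\mu^+$ let $\mathrm{FLP}^*(R;G,S,c)$ be the minimum of $$\sum_{e=xy\in E} c(e)\,D_\infty(\rho(x),\rho(y))$$ over all maps $\rho:V\to R$ with $\rho(s)\in R_s$ for every $s\in S$ (here $x$ is the tail and $y$ the head of $e$). Then: (1) For every network $(G,S,c)$, the optima $\mathrm{MFP}^*(\mu;G,S,c)$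 and $\mathrm{FLP}^*(T_\mu;G,S,c)$ are attained, and $$\mathrm{MFP}^*(\mu;G,S,c)=\mathrm{FLP}^*(T_\mu;G,S,c).$$ (2) For every balanced section $R\subseteq Q_\mu^+$ and every inner Eulerian network $(G,S,c)$, the optima $\mathrm{MFP}^*(\mu;G,S,c)$ and $\mathrm{FLP}^*(R;G,S,c)$ are attained, and $$\mathrm{MFP}^*(\mu;G,S,c)=\mathrm{FLP}^*(R;G,S,c).$$ -/

import Mathlib

namespace DirectedMultiflow

/-- A directed distance on `S`: nonnegative, with zero diagonal (no symmetry, no triangle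
inequality). -/
structure IsDirectedDistance {S : Type*} (μ : S → S → ℝ) : Prop where
  nonneg : ∀ s t, 0 ≤ μ s t
  diag : ∀ s, μ s s = 0

/-! ### Networks -/

/-- A network `(G, S, c)`: a directed graph with node set `V` and edge set `E` (loops and parallel
edges are allowed), a set `S` of nodes called terminals (given by an injection into `V`), and
a nonnegative integer edge capacity. -/
structure Network (S V E : Type*) where
  tail : E → V
  head : E → V
  terminal : S ↪ V
  cap : E → ℕ

namespace Network

variable {S V E : Type*}

/-- `N.IsWalk x es y`: the list of edges `es` is a directed walk from `x` to `y`. -/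
def IsWalk (N : Network S V E) : V → List E → V → Prop
  | x, [], y => x = y
  | x, e :: es, y => N.tail e = x ∧ N.IsWalk (N.head e) es y

/-- An `S`-path: a directed path (no node is visited twice) joining distinct terminals.
Inner nodes of the path may be terminals. -/
structure SPath (N : Network S V E) where
  source : S
  target : S
  source_ne_target : source ≠ target
  edges : List E
  isWalk : N.IsWalk (N.terminal source) edges (N.terminal target)
  nodup : (N.terminal source :: edges.map N.head).Nodup

open Classical in
/-- A multiflow: a set `paths` of `S`-paths (there are only finitely many `S`-paths in a finite
graph) with nonnegative flow values satisfying the capacity constraint. -/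
structure Multiflow (N : Network S V E) where
  paths : Finset N.SPath
  flow : N.SPath → ℝ
  flow_nonneg : ∀ P ∈ paths, 0 ≤ flow P
  capacity : ∀ e : E, ∑ P ∈ paths with e ∈ P.edges, flow P ≤ (N.cap e : ℝ)

/-- The `μ`-weighted value of a multiflow. -/
def Multiflow.val {N : Network S V E} (f : N.Multiflow) (μ : S → S → ℝ) : ℝ :=
  ∑ P ∈ f.paths, f.flow P * μ P.source P.target

/-- The set of objective values of the `μ`-weighted maximum multiflow problem. -/
def mfpValues (N : Network S V E) (μ : S → S → ℝ) : Set ℝ :=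
  Set.range fun f : N.Multiflow => f.val μ

open Classical in
/-- The Eulerian condition at a node: leaving capacity equals entering capacity. -/
def EulerianAt [Fintype E] (N : Network S V E) (x : V) : Prop :=
  ∑ e : E with N.tail e = x, N.cap e = ∑ e : E with N.head e = x, N.cap e

/-- Every inner (that is, non-terminal) node fulfills the Eulerian condition. -/
def InnerEulerian [Fintype E] (N : Network S V E) : Prop :=
  ∀ x : V, x ∉ Set.range N.terminal → N.EulerianAt x

end Network

/-! ### The polyhedron, the directed tight span and the fiber of the tropical polytope -/

/-- The space `ℝ^{S^c ∪ S^r}`; a point is `p = (p^c, p^r)`, with the componentwise order. -/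
abbrev Pt (S : Type*) := (S → ℝ) × (S → ℝ)

section

variable {S : Type*}

/-- The polyhedron `P_μ`. -/
def P (μ : S → S → ℝ) : Set (Pt S) :=
  {p | ∀ s t, μ s t ≤ p.1 s + p.2 t}

/-- The set `R^+` of nonnegative points of `R`. -/
def nonnegPart (R : Set (Pt S)) : Set (Pt S) :=
  {p | p ∈ R ∧ 0 ≤ p}

/-- The set `R_s` of points `p` of `R` with `p(s^c) + p(s^r) = 0`. -/
def terminalPart (R : Set (Pt S)) (s : S) : Set (Pt S) :=
  {p | p ∈ R ∧ p.1 s + p.2 s = 0}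

/-- The directed tight span `T_μ`: the minimal elements of `P_μ^+`. -/
def T (μ : S → S → ℝ) : Set (Pt S) :=
  {p | Minimal (fun q => q ∈ nonnegPart (P μ)) p}

/-- The set `Q_μ` of minimal elements of `P_μ`. -/
def Q (μ : S → S → ℝ) : Set (Pt S) :=
  {p | Minimal (fun q => q ∈ P μ) p}

/-- The linearity space `(𝟙, -𝟙)ℝ` of `P_μ`. -/
def lineality (S : Type*) : Submodule ℝ (Pt S) :=
  Submodule.span ℝ {((1 : S → ℝ), (-1 : S → ℝ))}

/-- The tropical polytope: the image of `Q_μ` in the quotient by `(𝟙, -𝟙)ℝ`. -/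
def Qbar (μ : S → S → ℝ) : Set (Pt S ⧸ lineality S) :=
  (lineality S).mkQ '' Q μ

/-- `R ⊆ Q_μ` is a section if the projection `R → Q_μ / (𝟙, -𝟙)ℝ` is bijective. -/
def IsSection (μ : S → S → ℝ) (R : Set (Pt S)) : Prop :=
  R ⊆ Q μ ∧ Set.BijOn (lineality S).mkQ R (Qbar μ)

/-- `R` is balanced if it has no two points `p`, `q` with `p^c < q^c` or `p^r < q^r`, where
`<` means strict inequality in every coordinate. -/
def IsBalanced (R : Set (Pt S)) : Prop :=
  R.Pairwise fun p q => ¬ ((∀ s, p.1 s < q.1 s) ∨ (∀ s, p.2 s < q.2 s))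

variable [Fintype S]

/-- `D_∞^+(p, q) = ‖(q - p)_+‖_∞`. -/
noncomputable def Dplus (p q : S → ℝ) : ℝ := ‖(q - p)⁺‖

/-- The directed metric `D_∞` on `ℝ^{S^c ∪ S^r}`. -/
noncomputable def D (p q : Pt S) : ℝ := max (Dplus p.1 q.1) (Dplus q.2 p.2)

end

/-! ### The facility location problem -/

namespace Network

variable {S V E : Type*}

/-- Feasible maps of the facility location problem on `R`. -/
def FLPFeasible (N : Network S V E) (R : Set (Pt S)) (ρ : V → Pt S) : Prop :=
  (∀ x, ρ x ∈ R) ∧ ∀ s, ρ (N.terminal s) ∈ terminalPart R s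

/-- The objective function of the facility location problem. -/
noncomputable def flpCost [Fintype S] [Fintype E] (N : Network S V E) (ρ : V → Pt S) : ℝ :=
  ∑ e : E, (N.cap e : ℝ) * D (ρ (N.tail e)) (ρ (N.head e))

/-- The set of objective values of the facility location problem on `R`. -/
def flpValues [Fintype S] [Fintype E] (N : Network S V E) (R : Set (Pt S)) : Set ℝ :=
  N.flpCost '' {ρ | N.FLPFeasible R ρ}

/-- The multiflow problem and the facility location problem on `R` both attain their optima
(maximum and minimum respectively), and the optimal values are equal. -/
def StrongDuality [Fintype S] [Fintype E] (N : Network S V E) (μ : S → S → ℝ)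
    (R : Set (Pt S)) : Prop :=
  ∃ v : ℝ, IsGreatest (N.mfpValues μ) v ∧ IsLeast (N.flpValues R) v

end Network

end DirectedMultiflow

universe u v w

/-! Weak duality: a feasible `ρ` gives edge lengths `D`, and the `s`-th `c`-coordinate is a
potential that rises from 0 to at least `μ s t` along any path from `s` to `t`. Conversely, linear
programming duality (`exists_length`) turns an upper bound `v` on flow values into edge lengths `l`
of total cost at most `v` for which every `S`-path is at least as long as `μ` demands. Truncated
distances from the terminals, conjugated twice through `μ`, send the nodes to minimal points without
stretching any edge beyond `l` (`exists_minimal_embedding`). Conjugation truncated at 0 lands in `T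
μ`, which gives (1). For (2), untruncated conjugation lands in `Q μ`, and each node `x` is then
shifted along the lineality direction by `α x` into `R`. Balancedness (`IsBalanced.D_le`) bounds the
new length of an edge by `l + α(head) - α(tail)`; in an inner Eulerian network these corrections sum
to 0. -/

namespace DirectedMultiflow

/-! ### Linear programming duality -/

/-- Linear programming duality for a packing-type problem satisfying Slater's condition. -/
theorem exists_dual_of_forall_le {ι κ : Type*} [Fintype ι] [Fintype κ] (A : κ → ι → ℝ)
    (c : κ → ℝ) (hc : ∀ k, 0 < c k) (w : ι → ℝ) (v : ℝ)
    (hv : ∀ x : ι → ℝ, 0 ≤ x → (∀ k, ∑ i, A k i * x i ≤ c k) → ∑ i, w i * x i ≤ v) :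
    ∃ y : κ → ℝ, 0 ≤ y ∧ ∑ k, y k * c k ≤ v ∧ ∀ i, w i ≤ ∑ k, y k * A k i := by
  classical
  -- Perturbations of the constraints paired with values strictly below what they allow; strictness
  -- makes `K` open, so `(0, v)` can be separated from it.
  let K : Set ((κ → ℝ) × ℝ) :=
    {q | ∃ x : ι → ℝ, 0 ≤ x ∧ (∀ k, ∑ i, A k i * x i - c k < q.1 k) ∧ q.2 < ∑ i, w i * x i}
  have hKc : Convex ℝ K := by
    rintro q ⟨x, hx, hq, hq'⟩ q₂ ⟨x₂, hx₂, hq₂, hq₂'⟩ a b ha hb hab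
    have aux : ∀ {s t s' t' : ℝ}, s < s' → t < t' → a * s + b * t < a * s' + b * t' := by
      intro s t s' t' h h'
      rcases ha.eq_or_lt with rfl | ha'
      · have : b = 1 := by linarith
        subst this; simpa using h'
      · nlinarith [mul_lt_mul_of_pos_left h ha', mul_le_mul_of_nonneg_left h'.le hb]
    have lin : ∀ g : ι → ℝ, ∑ i, g i * (a • x + b • x₂) i
        = a * ∑ i, g i * x i + b * ∑ i, g i * x₂ i := by
      intro g
      simp only [Pi.add_apply, Pi.smul_apply, smul_eq_mul, Finset.mul_sum,
        ← Finset.sum_add_distrib]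
      exact Finset.sum_congr rfl fun i _ => by ring
    refine ⟨a • x + b • x₂, by positivity, fun k => ?_, ?_⟩
    · rw [lin]
      have := aux (hq k) (hq₂ k)
      have hck : c k = a * c k + b * c k := by rw [← add_mul, hab, one_mul]
      simp only [Prod.fst_add, Prod.smul_fst, Pi.add_apply, Pi.smul_apply, smul_eq_mul]
      linarith
    · rw [lin]
      have := aux hq' hq₂'
      simpa using this
  have hKo : IsOpen K := by
    have : K = ⋃ x ∈ {x : ι → ℝ | 0 ≤ x}, ((⋂ k, {q : (κ → ℝ) × ℝ | ∑ i, A k i * x i - c k < q.1 k})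
        ∩ {q | q.2 < ∑ i, w i * x i}) := by
      ext q; simp [K, and_left_comm]
    rw [this]
    refine isOpen_biUnion fun x _ => IsOpen.inter (isOpen_iInter_of_finite fun k => ?_) ?_
    · exact isOpen_lt continuous_const (by fun_prop)
    · exact isOpen_lt (by fun_prop) continuous_const
  have hv' : ((0 : κ → ℝ), v) ∉ K := by
    rintro ⟨x, hx, h, h'⟩
    exact absurd (hv x hx fun k => by have := h k; simp at this; exact this.le) (not_le.2 h')
  obtain ⟨f, hf⟩ := geometric_hahn_banach_open_point hKc hKo hv'
  set a : ℝ := f (0, 1) with ha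
  set y : κ → ℝ := fun k => - f (Pi.single k 1, 0) with hy
  have hfe : ∀ u r, f (u, r) = a * r - ∑ k, y k * u k := by
    intro u r
    have h1 : ((u, r) : (κ → ℝ) × ℝ)
        = r • ((0 : κ → ℝ), (1 : ℝ)) + ∑ k, u k • ((Pi.single k 1 : κ → ℝ), (0 : ℝ)) := by
      ext j
      · simp [Prod.fst_sum, Finset.sum_apply, Pi.single_apply]
      · simp [Prod.snd_sum]
    rw [h1, map_add, map_smul, map_sum]
    simp only [map_smul, smul_eq_mul, hy, neg_mul, Finset.sum_neg_distrib, sub_neg_eq_add, ← ha]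
    rw [mul_comm]
    congr 1
    exact Finset.sum_congr rfl fun k _ => mul_comm _ _
  have key : ∀ x : ι → ℝ, 0 ≤ x → ∀ (u : κ → ℝ) (r : ℝ), (∀ k, ∑ i, A k i * x i - c k < u k) →
      r < ∑ i, w i * x i → a * r - ∑ k, y k * u k < a * v := by
    intro x hx u r hu hr
    have := hf (u, r) ⟨x, hx, hu, hr⟩
    rwa [hfe, hfe, show ∑ k, y k * (0 : κ → ℝ) k = 0 by simp, sub_zero] at this
  have ray : ∀ {b C d : ℝ}, (∀ n : ℝ, 0 ≤ n → n * C + b < d) → C ≤ 0 := by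
    intro b C d h
    by_contra! hC
    have := h (|d - b| / C) (by positivity)
    rw [div_mul_cancel₀ _ hC.ne'] at this
    linarith [le_abs_self (d - b)]
  have hy0 : ∀ k, 0 ≤ y k := by
    intro k
    have : - y k ≤ 0 := by
      refine ray (b := - a) (d := a * v) fun n hn => ?_
      have := key 0 le_rfl (Pi.single k n) (-1) (fun j => by
        have h0 : (0 : ℝ) ≤ (Pi.single k n : κ → ℝ) j := by
          rw [Pi.single_apply]; split_ifs <;> simp [hn]
        have := hc j
        simp; linarith) (by simp)
      simp [Pi.single_apply] at this
      linarith
    linarith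
  have hyc : 0 ≤ ∑ k, y k * c k := Finset.sum_nonneg fun k _ => mul_nonneg (hy0 k) (hc k).le
  have ha0 : 0 ≤ a := by
    have : - a ≤ 0 := by
      refine ray (b := - a) (d := a * v) fun n hn => ?_
      have := key 0 le_rfl 0 (-1 - n) (fun j => by simpa using hc j) (by simp; linarith)
      simp at this
      linarith
    linarith
  -- `x = 0` leaves slack `c k > 0` in every constraint; this rules out a vertical separating
  -- hyperplane, i.e. `a = 0`.
  have slater : ∀ ε > 0, a * (-ε) + (1 - ε) * ∑ k, y k * c k < a * v := by
    intro ε hε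
    have := key 0 le_rfl (fun k => - ((1 - ε) * c k)) (-ε)
      (fun k => by simp; nlinarith [hc k, mul_pos hε (hc k)]) (by simpa using hε)
    have e : ∑ k, y k * (-((1 - ε) * c k)) = - ((1 - ε) * ∑ k, y k * c k) := by
      rw [Finset.mul_sum, ← Finset.sum_neg_distrib]
      exact Finset.sum_congr rfl fun k _ => by ring
    rw [e] at this
    linarith
  have hapos : 0 < a := by
    refine ha0.lt_of_ne fun h => ?_
    have := slater (1 / 2) (by norm_num)
    rw [← h] at this
    linarith
  refine ⟨fun k => y k / a, fun k => div_nonneg (hy0 k) ha0, ?_, fun i => ?_⟩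
  · simp only [div_mul_eq_mul_div, ← Finset.sum_div]
    rw [div_le_iff₀ hapos]
    by_contra! h
    set B := ∑ k, y k * c k
    have hB : 0 < B + a := by linarith
    -- This `ε` makes the left side of `slater` exactly `a * v`.
    have := slater ((B - v * a) / (B + a)) (div_pos (by linarith) hB)
    have e : (B - v * a) / (B + a) * (B + a) = B - v * a := div_mul_cancel₀ _ hB.ne'
    nlinarith
  · simp only [div_mul_eq_mul_div, ← Finset.sum_div]
    rw [le_div_iff₀ hapos]
    have : a * w i - ∑ k, y k * A k i ≤ 0 := by
      refine ray (b := - a) (d := a * v) fun n hn => ?_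
      have := key (Pi.single i n) (by simpa using hn) (fun k => A k i * n) (w i * n - 1)
        (fun k => by simpa [Pi.single_apply] using hc k) (by simp [Pi.single_apply])
      simp only [← mul_assoc, ← Finset.sum_mul] at this
      linarith
    linarith

end DirectedMultiflow

/-! ### Walks, paths and attainment of the maximum multiflow -/

namespace DirectedMultiflow

namespace Network

variable {S V E : Type*} (N : Network S V E)

theorem IsWalk.concat {N : Network S V E} {es : List E} {x : V} {e : E}
    (h : N.IsWalk x es (N.tail e)) : N.IsWalk x (es ++ [e]) (N.head e) := by
  induction es generalizing x with
  | nil => exact ⟨h.symm, rfl⟩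
  | cons a es ih => exact ⟨h.1, ih h.2⟩

theorem IsWalk.sub_le_sum {N : Network S V E} {π : V → ℝ} {l : E → ℝ}
    (hπ : ∀ e, π (N.head e) - π (N.tail e) ≤ l e) {es : List E} {x y : V}
    (h : N.IsWalk x es y) : π y - π x ≤ (es.map l).sum := by
  induction es generalizing x with
  | nil => cases h; simp
  | cons e es ih =>
    have h1 := ih h.2
    have h2 := hπ e
    rw [h.1] at h2
    simp only [List.map_cons, List.sum_cons]
    linarith

theorem IsWalk.exists_suffix {N : Network S V E} {es : List E} {x y z : V}
    (h : N.IsWalk z es y) (hn : (z :: es.map N.head).Nodup) (hx : x ∈ z :: es.map N.head) :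
    ∃ es', N.IsWalk x es' y ∧ (x :: es'.map N.head).Nodup ∧ es'.Sublist es := by
  induction es generalizing z with
  | nil =>
    obtain rfl : x = z := by simpa using hx
    exact ⟨[], h, by simp, by simp⟩
  | cons e es ih =>
    rcases List.mem_cons.1 hx with rfl | hx
    · exact ⟨e :: es, h, hn, List.Sublist.refl _⟩
    · obtain ⟨es', h1, h2, h3⟩ := ih h.2 (List.nodup_cons.1 hn).2 hx
      exact ⟨es', h1, h2, h3.cons _⟩

/-- Cut out loops. The sublist clause ensures that nonnegative lengths do not increase. -/
theorem IsWalk.exists_nodup {N : Network S V E} {es : List E} {x y : V} (h : N.IsWalk x es y) :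
    ∃ es', N.IsWalk x es' y ∧ (x :: es'.map N.head).Nodup ∧ es'.Sublist es := by
  induction es generalizing x with
  | nil => exact ⟨[], h, by simp, by simp⟩
  | cons e es ih =>
    obtain ⟨es', h1, h2, h3⟩ := ih h.2
    by_cases hx : x ∈ N.head e :: es'.map N.head
    · obtain ⟨es'', h4, h5, h6⟩ := h1.exists_suffix h2 hx
      exact ⟨es'', h4, h5, (h6.trans h3).cons _⟩
    · exact ⟨e :: es', ⟨h.1, h1⟩, List.nodup_cons.2 ⟨hx, h2⟩, h3.cons_cons _⟩

variable {N}

theorem SPath.nodup_edges (P : N.SPath) : P.edges.Nodup :=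
  List.Nodup.of_map _ (List.nodup_cons.1 P.nodup).2

theorem SPath.exists_mem_edges (P : N.SPath) : ∃ e, e ∈ P.edges := by
  rcases h : P.edges with _ | ⟨e, es⟩
  · have := P.isWalk
    rw [h] at this
    exact absurd (N.terminal.injective this) P.source_ne_target
  · exact ⟨e, by simp⟩

instance finite_sPath [Finite S] [Finite E] : Finite N.SPath := by
  classical
  have := Fintype.ofFinite E
  refine Finite.of_injective
    (fun P : N.SPath => (P.source, P.target, (⟨P.edges, P.nodup_edges⟩ : {l : List E // l.Nodup})))
    ?_
  rintro ⟨s, t, h, es, h1, h2⟩ ⟨s', t', h', es', h1', h2'⟩ h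
  simp only [Prod.mk.injEq, Subtype.mk.injEq] at h
  obtain ⟨rfl, rfl, rfl⟩ := h
  rfl

open Classical in
theorem SPath.sum_edges [Fintype E] (P : N.SPath) (l : E → ℝ) :
    (P.edges.map l).sum = ∑ e with e ∈ P.edges, l e := by
  rw [← List.sum_toFinset l P.nodup_edges]
  congr 1
  ext e; simp

open Classical in
theorem Multiflow.val_le_sum [Fintype E] (f : N.Multiflow) {μ : S → S → ℝ} {l : E → ℝ}
    (hl : 0 ≤ l) (h : ∀ P ∈ f.paths, μ P.source P.target ≤ (P.edges.map l).sum) :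
    f.val μ ≤ ∑ e, (N.cap e : ℝ) * l e := by
  calc f.val μ ≤ ∑ P ∈ f.paths, f.flow P * (P.edges.map l).sum :=
        Finset.sum_le_sum fun P hP => mul_le_mul_of_nonneg_left (h P hP) (f.flow_nonneg P hP)
    _ = ∑ P ∈ f.paths, ∑ e, if e ∈ P.edges then f.flow P * l e else 0 := by
        refine Finset.sum_congr rfl fun P _ => ?_
        rw [P.sum_edges, Finset.mul_sum, Finset.sum_filter]
    _ = ∑ e, (∑ P ∈ f.paths with e ∈ P.edges, f.flow P) * l e := by
        rw [Finset.sum_comm]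
        refine Finset.sum_congr rfl fun e _ => ?_
        rw [Finset.sum_mul, Finset.sum_filter]
    _ ≤ _ := Finset.sum_le_sum fun e _ => mul_le_mul_of_nonneg_right (f.capacity e) (hl e)

-- Compactness: there are finitely many `S`-paths, and each has an edge because its ends differ, so
-- its flow is bounded.
open Classical in
theorem exists_isGreatest_mfpValues [Finite S] [Finite E] (N : Network S V E) (μ : S → S → ℝ) :
    ∃ v, IsGreatest (N.mfpValues μ) v := by
  have := Fintype.ofFinite N.SPath
  have := Fintype.ofFinite E
  let F : Set (N.SPath → ℝ) :=
    {x | 0 ≤ x ∧ ∀ e, ∑ P with e ∈ P.edges, x P ≤ (N.cap e : ℝ)}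
  have hFc : IsClosed F := by
    have h : F = Set.Ici 0 ∩ ⋂ e, {x | ∑ P with e ∈ P.edges, x P ≤ (N.cap e : ℝ)} := by
      ext x; simp [F]
    rw [h]
    exact isClosed_Ici.inter <| isClosed_iInter fun e => isClosed_le (by fun_prop) continuous_const
  have hFb : F ⊆ Set.Icc 0 (fun _ => ∑ e, (N.cap e : ℝ)) := by
    rintro x ⟨hx, hx'⟩
    refine ⟨hx, fun P => ?_⟩
    obtain ⟨e, he⟩ := P.exists_mem_edges
    calc x P ≤ ∑ P with e ∈ P.edges, x P :=
          Finset.single_le_sum (f := x) (fun P _ => hx P) (by simpa using he)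
      _ ≤ N.cap e := hx' e
      _ ≤ _ := Finset.single_le_sum (f := fun e => (N.cap e : ℝ))
          (fun e _ => Nat.cast_nonneg _) (Finset.mem_univ e)
  have hF : IsCompact F := isCompact_Icc.of_isClosed_subset hFc hFb
  obtain ⟨x, hx, hmax⟩ := hF.exists_isMaxOn (f := fun x => ∑ P, x P * μ P.source P.target)
    ⟨0, le_rfl, fun e => by simp⟩ (by fun_prop)
  refine ⟨_, ⟨⟨Finset.univ, x, fun P _ => hx.1 P, hx.2⟩, rfl⟩, ?_⟩
  rintro _ ⟨f, rfl⟩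
  have hf : (fun P => if P ∈ f.paths then f.flow P else 0) ∈ F := by
    refine ⟨fun P => ?_, fun e => ?_⟩
    · dsimp only
      split_ifs with h
      exacts [f.flow_nonneg P h, le_rfl]
    · refine le_trans (le_of_eq ?_) (f.capacity e)
      rw [← Finset.sum_filter, Finset.filter_filter]
      refine Finset.sum_congr ?_ fun _ _ => rfl
      ext P; simp [and_comm]
  have := hmax hf
  simp only [Set.mem_ofPred_eq, ite_mul, zero_mul, ← Finset.sum_filter] at this
  simpa [Multiflow.val] using this

end Network
end DirectedMultiflow

/-! ### Geometry of `D`, conjugation and balanced sets -/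

namespace DirectedMultiflow

section Geometry

variable {S : Type*} [Fintype S]

theorem Dplus_le_iff {p q : S → ℝ} {a : ℝ} (ha : 0 ≤ a) :
    Dplus p q ≤ a ↔ ∀ s, q s - p s ≤ a := by
  rw [Dplus, pi_norm_le_iff_of_nonneg ha]
  refine forall_congr' fun s => ?_
  rw [Pi.posPart_apply, Real.norm_of_nonneg (posPart_nonneg _), posPart_def]
  simp [ha]

theorem D_le_iff {p q : Pt S} {a : ℝ} (ha : 0 ≤ a) :
    D p q ≤ a ↔ (∀ s, q.1 s - p.1 s ≤ a) ∧ ∀ s, p.2 s - q.2 s ≤ a := by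
  rw [D, max_le_iff, Dplus_le_iff ha, Dplus_le_iff ha]

theorem D_nonneg (p q : Pt S) : 0 ≤ D p q := le_max_of_le_left (norm_nonneg _)

omit [Fintype S] in
theorem eq_zero_of_mem_terminalPart {R : Set (Pt S)} {s : S} {p : Pt S} (h0 : 0 ≤ p)
    (hp : p ∈ terminalPart R s) : p.1 s = 0 ∧ p.2 s = 0 := by
  have h1 : 0 ≤ p.1 s := h0.1 s
  have h2 : 0 ≤ p.2 s := h0.2 s
  have h3 := hp.2
  constructor <;> linarith

theorem exists_nonneg_upper_bound (μ : S → S → ℝ) : ∃ M, 0 ≤ M ∧ ∀ s t, μ s t ≤ M := by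
  obtain ⟨M, hM⟩ := (Set.finite_range fun st : S × S => μ st.1 st.2).bddAbove
  exact ⟨max 0 M, le_max_left _ _, fun s t => le_max_of_le_right (hM ⟨(s, t), rfl⟩)⟩

/-- The `μ`-conjugation map, truncated below at zero when `z` holds. -/
theorem exists_conjugation (z : Prop) (h : z ∨ Nonempty S) (μ : S → S → ℝ) :
    ∃ g : (S → ℝ) → S → ℝ, ∀ f s a, g f s ≤ a ↔ (z → 0 ≤ a) ∧ ∀ t, μ s t - f t ≤ a := by
  classical
  have hsup : ∀ [Nonempty S] (f : S → ℝ) (s : S) (a : ℝ),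
      (⨆ t, (μ s t - f t)) ≤ a ↔ ∀ t, μ s t - f t ≤ a :=
    fun f s a => ciSup_le_iff (Set.finite_range _).bddAbove
  by_cases hz : z
  · rcases isEmpty_or_nonempty S with hS | hS
    · exact ⟨fun f s => 0, fun f s => isEmptyElim s⟩
    · exact ⟨fun f s => max 0 (⨆ t, (μ s t - f t)), fun f s a => by
        rw [max_le_iff, hsup]; simp [hz]⟩
  · have := h.resolve_left hz
    exact ⟨fun f s => ⨆ t, (μ s t - f t), fun f s a => by rw [hsup]; simp [hz]⟩

/-- If `p` and `q` are shifted into a balanced set, then their distance changes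
at most by the difference of the shifts. -/
theorem IsBalanced.D_le [Nonempty S] {R : Set (Pt S)} (hR : IsBalanced R) {p q : Pt S} {a b l : ℝ}
    (hp : p + a • ((1 : S → ℝ), (-1 : S → ℝ)) ∈ R) (hq : q + b • ((1 : S → ℝ), (-1 : S → ℝ)) ∈ R)
    (hl : 0 ≤ l) (h : D p q ≤ l) :
    D (p + a • ((1 : S → ℝ), (-1 : S → ℝ))) (q + b • ((1 : S → ℝ), (-1 : S → ℝ)))
      ≤ l + (b - a) := by
  obtain ⟨h1, h2⟩ := (D_le_iff hl).1 h
  set p' := p + a • ((1 : S → ℝ), (-1 : S → ℝ)) with hp'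
  set q' := q + b • ((1 : S → ℝ), (-1 : S → ℝ)) with hq'
  have h1' : ∀ s, q'.1 s - p'.1 s ≤ l + (b - a) := fun s => by
    have := h1 s
    simp [hp', hq']
    linarith
  have h2' : ∀ s, p'.2 s - q'.2 s ≤ l + (b - a) := fun s => by
    have := h2 s
    simp [hp', hq']
    linarith
  refine (D_le_iff ?_).2 ⟨h1', h2'⟩
  -- Since `D` is truncated at 0, it remains to see `0 ≤ l + (b - a)`; balancedness forbids `q'.1 <
  -- p'.1` in every coordinate.
  obtain ⟨s, hs⟩ : ∃ s, p'.1 s ≤ q'.1 s := by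
    by_cases hpq : p' = q'
    · exact ⟨Classical.arbitrary S, by rw [hpq]⟩
    · have := hR hq hp (Ne.symm hpq)
      push Not at this
      exact this.1
  linarith [h1' s]

end Geometry

/-! ### Weak and strong duality -/

namespace Network

variable {S V E : Type*} [Fintype S] [Fintype E] {N : Network S V E} {μ : S → S → ℝ}

theorem Multiflow.val_le_flpCost (f : N.Multiflow) {R : Set (Pt S)} (hR : R ⊆ nonnegPart (P μ))
    {ρ : V → Pt S} (hρ : N.FLPFeasible R ρ) : f.val μ ≤ N.flpCost ρ := by
  refine f.val_le_sum (fun e => D_nonneg _ _) fun W _ => ?_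
  have h := W.isWalk.sub_le_sum (π := fun x => (ρ x).1 W.source)
    (l := fun e => D (ρ (N.tail e)) (ρ (N.head e)))
    fun e => ((D_le_iff (D_nonneg _ _)).1 le_rfl).1 _
  have hs := (eq_zero_of_mem_terminalPart (hR (hρ.1 _)).2 (hρ.2 W.source)).1
  have ht := (eq_zero_of_mem_terminalPart (hR (hρ.1 _)).2 (hρ.2 W.target)).2
  have := (hR (hρ.1 (N.terminal W.target))).1 W.source W.target
  rw [hs] at h
  linarith

theorem strongDuality_of_exists {R : Set (Pt S)} (hR : R ⊆ nonnegPart (P μ))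
    (h : ∀ v ∈ upperBounds (N.mfpValues μ), ∃ ρ, N.FLPFeasible R ρ ∧ N.flpCost ρ ≤ v) :
    N.StrongDuality μ R := by
  obtain ⟨v, hv⟩ := exists_isGreatest_mfpValues N μ
  obtain ⟨ρ, hρ, hc⟩ := h v hv.2
  obtain ⟨f, hf⟩ := hv.1
  simp only at hf
  refine ⟨v, hv, ⟨ρ, hρ, hc.antisymm ?_⟩, ?_⟩
  · exact hf ▸ f.val_le_flpCost hR hρ
  · rintro _ ⟨ρ', hρ', rfl⟩
    exact hf ▸ f.val_le_flpCost hR hρ'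

open Classical in
/-- Linear programming duality for the maximum multiflow problem. -/
theorem exists_length {v : ℝ} (hv : v ∈ upperBounds (N.mfpValues μ)) :
    ∃ l : E → ℝ, 0 ≤ l ∧ ∑ e, (N.cap e : ℝ) * l e ≤ v ∧
      ∀ W : N.SPath, μ W.source W.target ≤ (W.edges.map l).sum := by
  have := Fintype.ofFinite N.SPath
  -- Only paths avoiding zero-capacity edges, so those capacities can be replaced by 1 to meet the
  -- positivity hypothesis.
  let ι := {W : N.SPath // ∀ e ∈ W.edges, N.cap e ≠ 0}
  obtain ⟨y, hy, hyc, hyw⟩ := exists_dual_of_forall_le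
    (fun (e : E) (W : ι) => if e ∈ W.1.edges then (1 : ℝ) else 0)
    (fun e => if N.cap e = 0 then (1 : ℝ) else N.cap e)
    (fun e => by
      split_ifs with h
      exacts [one_pos, by exact_mod_cast Nat.pos_of_ne_zero h])
    (fun W : ι => μ W.1.source W.1.target) v (by
      intro x hx hxc
      let f : N.Multiflow :=
        { paths := Finset.univ.filter fun W => ∀ e ∈ W.edges, N.cap e ≠ 0
          flow := fun W => if h : ∀ e ∈ W.edges, N.cap e ≠ 0 then x ⟨W, h⟩ else 0
          flow_nonneg := fun W _ => by
            split_ifs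
            exacts [hx _, le_rfl]
          capacity := fun e => by
            rw [Finset.sum_filter, Finset.sum_subtype (p := fun W : N.SPath =>
              ∀ e ∈ W.edges, N.cap e ≠ 0) _ (fun W => by simp)]
            by_cases he : N.cap e = 0
            · refine le_of_eq_of_le (Finset.sum_eq_zero fun W _ => if_neg fun h => W.2 e h he) ?_
              positivity
            · refine le_of_eq_of_le (Finset.sum_congr rfl fun W _ => ?_)
                ((hxc e).trans_eq (if_neg he))
              rw [dif_pos W.2, ite_mul, one_mul, zero_mul] }
      refine le_of_eq_of_le ?_ (hv ⟨f, rfl⟩)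
      simp only [Multiflow.val, f]
      rw [Finset.sum_subtype (p := fun W : N.SPath =>
              ∀ e ∈ W.edges, N.cap e ≠ 0) _ (fun W => by simp)]
      refine Finset.sum_congr rfl fun W _ => ?_
      rw [dif_pos W.2, mul_comm])
  obtain ⟨M, hM0, hM⟩ := exists_nonneg_upper_bound μ
  have hl : ∀ e, 0 ≤ if N.cap e = 0 then M else y e := fun e => by
    split_ifs
    exacts [hM0, hy e]
  -- Length `M` on zero-capacity edges costs nothing and makes every path through them long enough.
  refine ⟨fun e => if N.cap e = 0 then M else y e, hl, ?_, fun W => ?_⟩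
  · refine (Finset.sum_le_sum fun e _ => ?_).trans hyc
    split_ifs with h
    · simpa [h] using hy e
    · simp only [h, if_false, mul_comm, le_refl]
  · rw [W.sum_edges]
    by_cases hW : ∀ e ∈ W.edges, N.cap e ≠ 0
    · refine (hyw ⟨W, hW⟩).trans_eq ?_
      rw [Finset.sum_filter]
      refine Finset.sum_congr rfl fun e _ => ?_
      split_ifs with h1 h2
      exacts [absurd h2 (hW e h1), mul_one _, mul_zero _]
    · push Not at hW
      obtain ⟨e, he, hc⟩ := hW
      refine (hM _ _).trans ?_
      have := Finset.single_le_sum (s := Finset.univ.filter (· ∈ W.edges))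
        (f := fun e => if N.cap e = 0 then M else y e) (fun e _ => hl e)
        (a := e) (by simpa using he)
      simpa [hc] using this

omit [Fintype E] in
/-- Truncated distances from the terminals with respect to a length function. -/
theorem exists_potential (hμ : IsDirectedDistance μ) {l : E → ℝ} (hl : 0 ≤ l)
    (h : ∀ W : N.SPath, μ W.source W.target ≤ (W.edges.map l).sum) :
    ∃ π : V → S → ℝ, (∀ x s, 0 ≤ π x s) ∧ (∀ s, π (N.terminal s) s ≤ 0) ∧
      (∀ e s, π (N.head e) s ≤ π (N.tail e) s + l e) ∧
      ∀ s t, μ s t ≤ π (N.terminal t) s := by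
  obtain ⟨M, hM0, hM⟩ := exists_nonneg_upper_bound μ
  -- Including `M` keeps the set nonempty at unreachable nodes, and `M` still dominates `μ`.
  let A : V → S → Set ℝ := fun x s =>
    {a | a = M ∨ ∃ es, N.IsWalk (N.terminal s) es x ∧ (es.map l).sum = a}
  have hA0 : ∀ x s, ∀ a ∈ A x s, 0 ≤ a := by
    rintro x s a (rfl | ⟨es, -, rfl⟩)
    · exact hM0
    · refine List.sum_nonneg fun b hb => ?_
      obtain ⟨e, -, rfl⟩ := List.mem_map.1 hb
      exact hl e
  have hAb : ∀ x s, BddBelow (A x s) := fun x s => ⟨0, hA0 x s⟩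
  have hAn : ∀ x s, (A x s).Nonempty := fun x s => ⟨M, Or.inl rfl⟩
  refine ⟨fun x s => sInf (A x s), fun x s => le_csInf (hAn x s) (hA0 x s), fun s => ?_,
    fun e s => ?_, fun s t => ?_⟩
  · exact csInf_le (hAb _ _) (Or.inr ⟨[], rfl, rfl⟩)
  · rw [← sub_le_iff_le_add]
    refine le_csInf (hAn _ _) ?_
    rintro a (rfl | ⟨es, hes, rfl⟩)
    · have := csInf_le (hAb (N.head e) s) (Or.inl rfl)
      have := hl e
      simp only [Pi.zero_apply] at this
      linarith
    · have := csInf_le (hAb (N.head e) s) (Or.inr ⟨es ++ [e], hes.concat, rfl⟩)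
      simp only [List.map_append, List.map_cons, List.map_nil, List.sum_append, List.sum_cons,
        List.sum_nil, add_zero] at this
      linarith
  · refine le_csInf (hAn _ _) ?_
    rintro a (rfl | ha)
    · exact hM s t
    · by_cases hst : s = t
      · rw [hst, hμ.diag]
        exact hA0 _ _ a (Or.inr ha)
      · obtain ⟨es, hes, rfl⟩ := ha
        obtain ⟨es', h1, h2, h3⟩ := hes.exists_nodup
        refine (h ⟨s, t, hst, es', h1, h2⟩).trans ?_
        refine (h3.map l).sum_le_sum fun b hb => ?_
        obtain ⟨e, -, rfl⟩ := List.mem_map.1 hb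
        exact hl e

omit [Fintype E] in
/-- Embedding of a network with a length function into the minimal elements of `P_μ^+` (if `z`
holds) or of `P_μ` (otherwise), without increasing lengths. -/
theorem exists_minimal_embedding (hμ : IsDirectedDistance μ) {l : E → ℝ} (hl : 0 ≤ l)
    (h : ∀ W : N.SPath, μ W.source W.target ≤ (W.edges.map l).sum) (z : Prop)
    (hz : z ∨ Nonempty S) :
    ∃ ρ : V → Pt S, (∀ x, Minimal (fun q => q ∈ P μ ∧ (z → 0 ≤ q)) (ρ x)) ∧
      (∀ s, (ρ (N.terminal s)).1 s = 0 ∧ (ρ (N.terminal s)).2 s = 0) ∧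
      ∀ e, D (ρ (N.tail e)) (ρ (N.head e)) ≤ l e := by
  obtain ⟨π, hπ0, hπs, hπe, hπμ⟩ := exists_potential hμ hl h
  obtain ⟨g, hg⟩ := exists_conjugation z hz μ
  obtain ⟨g', hg'⟩ := exists_conjugation z hz fun t s => μ s t
  set r : V → S → ℝ := fun x => g' (π x) with hr
  set c : V → S → ℝ := fun x => g (r x) with hc
  have hr1 : ∀ x s t, μ s t - π x s ≤ r x t := fun x s t => ((hg' _ _ _).1 le_rfl).2 s
  have hc1 : ∀ x s t, μ s t - r x t ≤ c x s := fun x s t => ((hg _ _ _).1 le_rfl).2 t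
  have hr0 : ∀ x t, z → 0 ≤ r x t := fun x t => ((hg' _ _ _).1 le_rfl).1
  have hc0 : ∀ x t, z → 0 ≤ c x t := fun x t => ((hg _ _ _).1 le_rfl).1
  have hcπ : ∀ x s, c x s ≤ π x s := fun x s =>
    (hg _ _ _).2 ⟨fun _ => hπ0 x s, fun t => by linarith [hr1 x s t]⟩
  have hrt : ∀ t, r (N.terminal t) t ≤ 0 := fun t =>
    (hg' _ _ _).2 ⟨fun _ => le_rfl, fun s => by linarith [hπμ s t]⟩
  refine ⟨fun x => (c x, r x), fun x => ⟨⟨fun s t => ?_, fun hz => ⟨fun s => hc0 x s hz,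
    fun s => hr0 x s hz⟩⟩, fun q hq hqx => ⟨fun s => ?_, fun t => ?_⟩⟩, fun s => ?_, fun e => ?_⟩
  · linarith [hc1 x s t]
  · refine (hg _ _ _).2 ⟨fun hz => (hq.2 hz).1 s, fun t => ?_⟩
    have h1 := hq.1 s t
    have h2 : q.2 t ≤ r x t := hqx.2 t
    linarith
  -- `r` is the conjugate of `π`, not of `c`; `c ≤ π` bridges the gap.
  · refine (hg' _ _ _).2 ⟨fun hz => (hq.2 hz).2 t, fun s => ?_⟩
    have h1 := hq.1 s t
    have h2 : q.1 s ≤ c x s := hqx.1 s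
    linarith [hcπ x s]
  · have h1 := hc1 (N.terminal s) s s
    have h2 := hcπ (N.terminal s) s
    have h3 := hr1 (N.terminal s) s s
    rw [hμ.diag] at h1 h3
    constructor <;> dsimp only <;> linarith [hrt s, hπs s]
  · have hle : 0 ≤ l e := hl e
    have hre : ∀ t, r (N.tail e) t ≤ r (N.head e) t + l e := fun t =>
      (hg' _ _ _).2 ⟨fun hz => add_nonneg (hr0 _ t hz) hle, fun s => by
        linarith [hr1 (N.head e) s t, hπe e s]⟩
    have hce : ∀ s, c (N.head e) s ≤ c (N.tail e) s + l e := fun s =>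
      (hg _ _ _).2 ⟨fun hz => add_nonneg (hc0 _ s hz) hle, fun t => by
        linarith [hc1 (N.tail e) s t, hre t]⟩
    exact (D_le_iff hle).2 ⟨fun s => by linarith [hce s], fun s => by linarith [hre s]⟩

-- Grouped by nodes, `α x` is weighted by entering minus leaving capacity, which is 0 at inner
-- nodes.
open Classical in
omit [Fintype S] in
theorem InnerEulerian.sum_cap_mul_sub_eq_zero [Fintype V] (hN : N.InnerEulerian) {α : V → ℝ}
    (hα : ∀ s, α (N.terminal s) = 0) :
    ∑ e, (N.cap e : ℝ) * (α (N.head e) - α (N.tail e)) = 0 := by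
  have fib : ∀ f : E → V, ∑ e, (N.cap e : ℝ) * α (f e)
      = ∑ x, ((∑ e with f e = x, N.cap e : ℕ) : ℝ) * α x := by
    intro f
    rw [← Finset.sum_fiberwise Finset.univ f]
    refine Finset.sum_congr rfl fun x _ => ?_
    rw [Nat.cast_sum, Finset.sum_mul]
    refine Finset.sum_congr rfl fun e he => ?_
    rw [(Finset.mem_filter.1 he).2]
  simp only [mul_sub, Finset.sum_sub_distrib, fib]
  rw [← Finset.sum_sub_distrib]
  refine Finset.sum_eq_zero fun x _ => ?_
  by_cases hx : x ∈ Set.range N.terminal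
  · obtain ⟨s, rfl⟩ := hx
    simp [hα]
  · have := hN x hx
    rw [EulerianAt] at this
    rw [this, sub_self]

theorem strongDuality_T (N : Network S V E) (hμ : IsDirectedDistance μ) :
    N.StrongDuality μ (T μ) := by
  refine strongDuality_of_exists (fun p hp => hp.1) fun v hv => ?_
  obtain ⟨l, hl, hlv, hlμ⟩ := exists_length hv
  obtain ⟨ρ, hρ, hρs, hρe⟩ := exists_minimal_embedding hμ hl hlμ True (Or.inl trivial)
  have hT : ∀ x, ρ x ∈ T μ := fun x => by simpa [T, nonnegPart] using hρ x
  refine ⟨ρ, ⟨hT, fun s => ⟨hT _, by simp [hρs s]⟩⟩, le_trans ?_ hlv⟩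
  exact Finset.sum_le_sum fun e _ => mul_le_mul_of_nonneg_left (hρe e) (Nat.cast_nonneg _)

theorem InnerEulerian.strongDuality_section [Fintype V] (hN : N.InnerEulerian)
    {R : Set (Pt S)} (hμ : IsDirectedDistance μ)
    (hR : R ⊆ nonnegPart (Q μ)) (hsec : IsSection μ R) (hbal : IsBalanced R) :
    N.StrongDuality μ R := by
  refine strongDuality_of_exists (fun p hp => ⟨(hR hp).1.1, (hR hp).2⟩) fun v hv => ?_
  have lift : ∀ p ∈ Q μ, ∃ a : ℝ, p + a • ((1 : S → ℝ), (-1 : S → ℝ)) ∈ R := by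
    intro p hp
    obtain ⟨q, hq, hqp⟩ := hsec.2.surjOn ⟨p, hp, rfl⟩
    obtain ⟨a, ha⟩ := Submodule.mem_span_singleton.1
      ((Submodule.Quotient.eq (lineality S)).1 hqp)
    exact ⟨a, by rwa [ha, add_sub_cancel]⟩
  rcases isEmpty_or_nonempty S with hS | hS
  · have hQ : (0 : Pt S) ∈ Q μ := ⟨fun s => isEmptyElim s, fun q _ _ => (Subsingleton.elim q 0).ge⟩
    obtain ⟨a, ha⟩ := lift 0 hQ
    refine ⟨fun _ => _, ⟨fun _ => ha, fun s => isEmptyElim s⟩, ?_⟩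
    have h0 : (0 : ℝ) ≤ v :=
      hv ⟨⟨∅, 0, fun _ _ => le_rfl, fun e => by simp⟩, by simp [Multiflow.val]⟩
    refine le_trans (le_of_eq (Finset.sum_eq_zero fun e _ => ?_)) h0
    rw [mul_eq_zero]
    exact Or.inr (((D_le_iff le_rfl).2 ⟨isEmptyElim, isEmptyElim⟩).antisymm (D_nonneg _ _))
  · obtain ⟨l, hl, hlv, hlμ⟩ := exists_length hv
    obtain ⟨ρ, hρ, hρs, hρe⟩ := exists_minimal_embedding hμ hl hlμ False (Or.inr hS)
    choose α hα using fun x => lift (ρ x) (by simpa [Q] using hρ x)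
    have hfeas : N.FLPFeasible R fun x => ρ x + α x • ((1 : S → ℝ), (-1 : S → ℝ)) :=
      ⟨hα, fun s => ⟨hα _, by simp [hρs s]⟩⟩
    -- `R` is nonnegative, so both `s`-coordinates at terminal `s` vanish after the shift, as they
    -- did before.
    have hα0 : ∀ s, α (N.terminal s) = 0 := fun s => by
      have := (eq_zero_of_mem_terminalPart (hR (hα _)).2 (hfeas.2 s)).1
      simpa [hρs s] using this
    refine ⟨_, hfeas, le_trans ?_ hlv⟩
    calc _ ≤ ∑ e, (N.cap e : ℝ) * (l e + (α (N.head e) - α (N.tail e))) :=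
          Finset.sum_le_sum fun e _ => mul_le_mul_of_nonneg_left
            (hbal.D_le (hα _) (hα _) (hl e) (hρe e)) (Nat.cast_nonneg _)
      _ = ∑ e, (N.cap e : ℝ) * l e := by
          simp only [mul_add, Finset.sum_add_distrib]
          rw [hN.sum_cap_mul_sub_eq_zero hα0, add_zero]

end Network
end DirectedMultiflow

theorem mainTheorem1 {S : Type u} [Fintype S] (μ : S → S → ℝ)
    (hμ : DirectedMultiflow.IsDirectedDistance μ) :
    (∀ (V : Type v) (E : Type w) [Fintype V] [Fintype E]
        (N : DirectedMultiflow.Network S V E),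
        N.StrongDuality μ (DirectedMultiflow.T μ)) ∧
    (∀ R : Set (DirectedMultiflow.Pt S),
        R ⊆ DirectedMultiflow.nonnegPart (DirectedMultiflow.Q μ) →
        DirectedMultiflow.IsSection μ R → DirectedMultiflow.IsBalanced R →
        ∀ (V : Type v) (E : Type w) [Fintype V] [Fintype E]
          (N : DirectedMultiflow.Network S V E), N.InnerEulerian →
          N.StrongDuality μ R) :=
  ⟨fun _ _ _ _ N => N.strongDuality_T hμ,
    fun _ hR hsec hbal _ _ _ _ _ hN => hN.strongDuality_section hμ hR hsec hbal⟩
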